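/- Setting. Let $\mathcal A,\mathcal B$ be abelian categories and let $\Phi:\mathcal A\rightleftarrows\mathcal B:\Psi$ be a right adjoint pair of contravariant (hence additive) functors, i.e. $\operatorname{Hom}_{\mathcal A}(X,\Psi Y)\cong\operatorname{Hom}_{\mathcal B}(Y,\Phi X)$ naturally in $X,Y$; let $\eta_X:X\to\Psi\Phi X$ be the unit. For $*\in\{\varnothing,+,-,b\}$ let $K^*(\mathcal A)$ be the homotopy category of (unbounded, bounded below, bounded above, bounded) cochain complexes and let $D^*(\mathcal A)$ be its localization at the quasi-isomorphisms; $D=D^{\varnothing}$. Extend contravariant functors to complexes by $(\Phi K)^n=\Phi(K^{-n})$. Fix $*,\dagger\in\{\varnothing,+,-,b\}$ such that $\Phi$ maps $K^*(\mathcal A)$ into $K^\dagger(\mathcal B)$. Assume that there is a triangulated subcategory $\mathcal P\subseteq K^*(\mathcal A)$ such that every $X\in K^*(\mathcal A)$ admits a quasi-isomorphism $P\to X$ with $P\in\mathcal P$, and such that $\Phi$ sends the exact complexes in $\mathcal P$ to exact complexes; and assume likewise that there is such a subcategory $\mathcal Q\subseteq K^\dagger(\mathcal B)$ for $\Psi$.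 Then the total right derived functors $\mathbf R\Phi:D^*(\mathcal A)^{op}\to D^\dagger(\mathcal B)$ and $\mathbf R\Psi:D^\dagger(\mathcal B)^{op}\to D(\mathcal A)$ exist and are computed by $\mathbf R\Phi X=\Phi P$ and $\mathbf R\Psi Y=\Psi Q$. Let $\hat\eta_X:X\to\mathbf R\Psi\,\mathbf R\Phi X$ be the derived unit, i.e. the unique morphism of $D(\mathcal A)$, natural in $X\in D^*(\mathcal A)$, such that for every complex $X$ in $K^*(\mathcal A)$ the composite of $\hat\eta_X$ with the canonical map $\mathbf R\Psi\,\mathbf R\Phi X\to\mathbf R\Psi(\Phi X)$ (the image under $\mathbf R\Psi$ of the canonical map $\Phi X\to\mathbf R\Phi X$) equals the composite $X\xrightarrow{\eta}\Psi\Phi X\to\mathbf R\Psi(\Phi X)$. Objects of $\mathcal A$ and $\mathcal B$ are regarded as stalk complexes in degree $0$. Definitions. An object $A$ of $\mathcal A$ is $\Phi$-acyclic if $H^i(\mathbf R\Phi A)=0$ for all $i\neq 0$; $\Psi$-acyclic objects of $\mathcal B$ are defined in the same way. Let $\mathcal G_{\Phi\Psi}$ be the class of the objects $A$ of $\mathcal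 A$ such that $A$ is $\Phi$-acyclic, $\Phi A$ is $\Psi$-acyclic, and $\eta_A:A\to\Psi\Phi A$ is an isomorphism. An object $A$ has finite $\mathcal G_{\Phi\Psi}$-dimension if, for some integer $n\ge 0$, there is an exact sequence $0\to G_n\to\cdots\to G_1\to G_0\to A\to 0$ in $\mathcal A$ in which every $G_i$ belongs to $\mathcal G_{\Phi\Psi}$ or is zero. An object $A$ is $\mathcal D$-reflexive if $\hat\eta_A:A\to\mathbf R\Psi\,\mathbf R\Phi A$ is an isomorphism in the derived category. Statement. Every object of $\mathcal A$ of finite $\mathcal G_{\Phi\Psi}$-dimension is $\mathcal D$-reflexive. -/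

import Mathlib

open CategoryTheory Limits Opposite Pretriangulated

universe w w' v u v' u'

namespace DerivedReflexive

section Resolutions

variable {T : Type u} [Category.{v} T] [HasZeroObject T] [HasShift T ℤ] [Preadditive T]
  [∀ n : ℤ, (shiftFunctor T n).Additive] [Pretriangulated T] [IsTriangulated T]
  {B P : ObjectProperty T} [B.IsTriangulated] [B.IsClosedUnderIsomorphisms] [P.IsTriangulated]

lemma inf_trW {X Y : T} (f : X ⟶ Y) (hX : P X) (hY : P Y) (hf : B.trW f) :
    (P ⊓ B).trW f := by
  obtain ⟨U, hU, a, b, hT⟩ := P.distinguished_cocone_triangle f hX hY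
  exact (ObjectProperty.trW_iff _ _).2 ⟨U, a, b, hT, hU, (B.trW_iff_of_distinguished _ hT).1 hf⟩

lemma isLeftDerivabilityStructure
    (hres : ∀ X : T, ∃ (Y : T) (f : Y ⟶ X), P Y ∧ B.trW f) :
    (P.triangulatedLocalizerMorphism B).IsLeftDerivabilityStructure := by
  let Λ := P.triangulatedLocalizerMorphism B
  have hΛ : Λ.HasLeftResolutions := fun X => by
    obtain ⟨Y, f, hY, hf⟩ := hres X
    exact ⟨{ X₁ := ⟨Y, hY⟩, w := f, hw := hf }⟩
  have : P.IsVerdierLeftLocalizing B := by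
    rw [ObjectProperty.isVerdierLeftLocalizing_iff]
    intro X Y g hY hg
    obtain ⟨Z, f, hZ, hf⟩ := hres X
    exact ⟨Z, f ≫ g, f, hZ, inf_trW _ hZ hY (B.trW.comp_mem _ _ hf hg), rfl⟩
  have : (Λ.localizedFunctor (B.inverseImage P.ι).trW.Q B.trW.Q).EssSurj := by
    have := Λ.essSurj_of_hasLeftResolutions B.trW.Q
    exact ⟨fun Y => ⟨(B.inverseImage P.ι).trW.Q.obj ((Λ.functor ⋙ B.trW.Q).objPreimage Y),
      ⟨(CatCommSq.iso Λ.functor (B.inverseImage P.ι).trW.Q B.trW.Q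
        (Λ.localizedFunctor (B.inverseImage P.ι).trW.Q B.trW.Q)).symm.app _ ≪≫
          (Λ.functor ⋙ B.trW.Q).objObjPreimageIso Y⟩⟩⟩
  have : (Λ.localizedFunctor (B.inverseImage P.ι).trW.Q B.trW.Q).IsEquivalence := { }
  have : Λ.IsLocalizedEquivalence :=
    LocalizerMorphism.IsLocalizedEquivalence.mk' Λ (B.inverseImage P.ι).trW.Q B.trW.Q
      (Λ.localizedFunctor (B.inverseImage P.ι).trW.Q B.trW.Q)
  have : Λ.arrow.HasLeftResolutions := fun f => by
    obtain ⟨Y, q, hY, hq⟩ := hres f.right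
    obtain ⟨φ, hφ⟩ := (MorphismProperty.LeftFraction.mk f.hom q hq).exists_rightFraction
    obtain ⟨X, p, hX, hp⟩ := hres φ.X'
    exact ⟨{
      X₁ := Arrow.mk (P.homMk (p ≫ φ.f) : (⟨X, hX⟩ : P.FullSubcategory) ⟶ ⟨Y, hY⟩)
      w := Arrow.homMk (p ≫ φ.s) q ((Category.assoc _ _ _).trans ((p ≫= hφ).trans (Category.assoc _ _ _).symm))
      hw := ⟨B.trW.comp_mem _ _ hp φ.hs, hq⟩ }⟩
  have (X : T) : IsConnected (Λ.LeftResolution X) := by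
    have : Nonempty (Λ.LeftResolution X) := hΛ X
    refine zigzag_isConnected (fun R R' => ?_)
    obtain ⟨φ, hφ⟩ := (MorphismProperty.LeftFraction.mk R.w R'.w R'.hw).exists_rightFraction
    obtain ⟨Z, p, hZ, hp⟩ := hres φ.X'
    let R'' : Λ.LeftResolution X :=
      { X₁ := ⟨Z, hZ⟩
        w := p ≫ φ.s ≫ R.w
        hw := B.trW.comp_mem _ _ hp (B.trW.comp_mem _ _ φ.hs R.hw) }
    let a : R'' ⟶ R :=
      { f := P.homMk (p ≫ φ.s)
        comm := Category.assoc _ _ _ }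
    let b : R'' ⟶ R' :=
      { f := P.homMk (p ≫ φ.f)
        comm := (Category.assoc _ _ _).trans (p ≫= hφ.symm) }
    exact (Zigzag.of_inv a).trans (Zigzag.of_hom b)
  exact LocalizerMorphism.IsLeftDerivabilityStructure.mk' Λ

variable {D : Type*} [Category* D] {H : Type*} [Category* H]

lemma hasPointwiseRightDerivedFunctor
    (W : MorphismProperty T) (hW : W = B.trW)
    (hres : ∀ X : T, ∃ (Y : T) (f : Y ⟶ X), P Y ∧ W f) (G : Tᵒᵖ ⥤ H)
    (hG : ∀ ⦃X Y : T⦄ (f : X ⟶ Y), P X → P Y → W f → IsIso (G.map f.op)) :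
    G.HasPointwiseRightDerivedFunctor W.op := by
  subst hW
  have := isLeftDerivabilityStructure hres
  refine LocalizerMorphism.Derives.hasPointwiseRightDerivedFunctor
    (Φ := (P.triangulatedLocalizerMorphism B).op) (fun X Y f hf => ?_)
  exact hG _ Y.unop.property X.unop.property
    ((P.triangulatedLocalizerMorphism B).map _ hf)

lemma isIso_of_isRightDerivedFunctor
    (W : MorphismProperty T) (hW : W = B.trW)
    (hres : ∀ X : T, ∃ (Y : T) (f : Y ⟶ X), P Y ∧ W f) (G : Tᵒᵖ ⥤ H)
    (hG : ∀ ⦃X Y : T⦄ (f : X ⟶ Y), P X → P Y → W f → IsIso (G.map f.op))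
    {L : Tᵒᵖ ⥤ D} [L.IsLocalization W.op] (RG : D ⥤ H)
    (α : G ⟶ L ⋙ RG) [RG.IsRightDerivedFunctor α W.op] (X : T) (hX : P X) :
    IsIso (α.app (op X)) := by
  subst hW
  have := isLeftDerivabilityStructure hres
  refine LocalizerMorphism.Derives.isIso_of_isRightDerivedFunctor
    (Φ := (P.triangulatedLocalizerMorphism B).op) (fun X Y f hf => ?_) α (op ⟨X, hX⟩)
  exact hG _ Y.unop.property X.unop.property
    ((P.triangulatedLocalizerMorphism B).map _ hf)

lemma isRightDerivedFunctor_of_isIso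
    (W : MorphismProperty T) (hW : W = B.trW)
    (hres : ∀ X : T, ∃ (Y : T) (f : Y ⟶ X), P Y ∧ W f) (G : Tᵒᵖ ⥤ H)
    (hG : ∀ ⦃X Y : T⦄ (f : X ⟶ Y), P X → P Y → W f → IsIso (G.map f.op))
    {L : Tᵒᵖ ⥤ D} [L.IsLocalization W.op] (RG : D ⥤ H)
    (α : G ⟶ L ⋙ RG) (hα : ∀ X : T, P X → IsIso (α.app (op X))) :
    RG.IsRightDerivedFunctor α W.op := by
  subst hW
  have := isLeftDerivabilityStructure hres
  refine LocalizerMorphism.Derives.isRightDerivedFunctor_of_isIso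
    (Φ := (P.triangulatedLocalizerMorphism B).op) (fun X Y f hf => ?_) α
    (fun X => hα _ X.unop.property)
  exact hG _ Y.unop.property X.unop.property
    ((P.triangulatedLocalizerMorphism B).map _ hf)

end Resolutions

section Complexes

variable (C : Type u) [Category.{v} C] [Abelian C]

/-- The four boundedness conditions `*` in `K^*(C)` and `D^*(C)`. -/
inductive Bound
  | unbounded
  | boundedBelow
  | boundedAbove
  | bounded

/-- The cochain complexes satisfying a boundedness condition. -/
def Bound.complexes : Bound → ObjectProperty (CochainComplex C ℤ)
  | .unbounded => fun _ => True
  | .boundedBelow => fun K => ∃ n : ℤ, K.IsStrictlyGE n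
  | .boundedAbove => fun K => ∃ n : ℤ, K.IsStrictlyLE n
  | .bounded => fun K => (∃ n : ℤ, K.IsStrictlyGE n) ∧ ∃ n : ℤ, K.IsStrictlyLE n

/-- The objects of the homotopy category `K(C)` satisfying a boundedness condition. -/
def Bound.homotopy (s : Bound) : ObjectProperty (HomotopyCategory C (.up ℤ)) :=
  fun X => s.complexes C X.as

variable {C}

lemma Bound.complexes_single (s : Bound) (X : C) (n : ℤ) :
    s.complexes C ((HomologicalComplex.single C (.up ℤ) n).obj X) := by
  cases s
  · trivial
  · exact ⟨n, inferInstance⟩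
  · exact ⟨n, inferInstance⟩
  · exact ⟨⟨n, inferInstance⟩, ⟨n, inferInstance⟩⟩

lemma Bound.complexes_zero (s : Bound) : s.complexes C (HomologicalComplex.zero) := by
  have hp : ∃ n : ℤ, CochainComplex.IsStrictlyGE (C := C) HomologicalComplex.zero n :=
    ⟨0, (CochainComplex.isStrictlyGE_iff _ _).2 fun _ _ => isZero_zero C⟩
  have hm : ∃ n : ℤ, CochainComplex.IsStrictlyLE (C := C) HomologicalComplex.zero n :=
    ⟨0, (CochainComplex.isStrictlyLE_iff _ _).2 fun _ _ => isZero_zero C⟩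
  cases s
  · trivial
  · exact hp
  · exact hm
  · exact ⟨hp, hm⟩

lemma Bound.complexes_shift (s : Bound) (K : CochainComplex C ℤ) (a : ℤ)
    (hK : s.complexes C K) : s.complexes C (K⟦a⟧) := by
  have hp : (∃ n : ℤ, K.IsStrictlyGE n) → ∃ n : ℤ, (K⟦a⟧).IsStrictlyGE n :=
    fun ⟨n, _⟩ => ⟨n - a, K.isStrictlyGE_shift n a (n - a) (by lia)⟩
  have hm : (∃ n : ℤ, K.IsStrictlyLE n) → ∃ n : ℤ, (K⟦a⟧).IsStrictlyLE n :=
    fun ⟨n, _⟩ => ⟨n - a, K.isStrictlyLE_shift n a (n - a) (by lia)⟩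
  cases s
  · trivial
  · exact hp hK
  · exact hm hK
  · exact ⟨hp hK.1, hm hK.2⟩

lemma Bound.complexes_mappingCone (s : Bound) {K L : CochainComplex C ℤ} (f : K ⟶ L)
    (hK : s.complexes C K) (hL : s.complexes C L) :
    s.complexes C (CochainComplex.mappingCone f) := by
  have hp : (∃ n : ℤ, K.IsStrictlyGE n) → (∃ n : ℤ, L.IsStrictlyGE n) →
      ∃ n : ℤ, (CochainComplex.mappingCone f).IsStrictlyGE n := by
    rintro ⟨n₁, _⟩ ⟨n₂, _⟩
    exact ⟨min (n₁ - 1) n₂, CochainComplex.isStrictlyGE_mappingCone f n₁ n₂ _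
      (by simp) (by simp)⟩
  have hm : (∃ n : ℤ, K.IsStrictlyLE n) → (∃ n : ℤ, L.IsStrictlyLE n) →
      ∃ n : ℤ, (CochainComplex.mappingCone f).IsStrictlyLE n := by
    rintro ⟨n₁, _⟩ ⟨n₂, _⟩
    refine ⟨max n₁ n₂, ?_⟩
    rw [CochainComplex.isStrictlyLE_iff]
    intro i hi
    simp only [sup_lt_iff] at hi
    simp only [CochainComplex.mappingCone.isZero_X_iff]
    exact ⟨K.isZero_of_isStrictlyLE n₁ _ (by lia), L.isZero_of_isStrictlyLE n₂ _ (by lia)⟩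
  cases s
  · trivial
  · exact hp hK hL
  · exact hm hK hL
  · exact ⟨hp hK.1 hL.1, hm hK.2 hL.2⟩

instance (s : Bound) : (s.homotopy C).ContainsZero where
  exists_zero := ⟨(HomotopyCategory.quotient _ _).obj HomologicalComplex.zero,
    Functor.map_isZero _ HomologicalComplex.isZero_zero, s.complexes_zero⟩

instance (s : Bound) : (s.homotopy C).IsStableUnderShift ℤ where
  isStableUnderShiftBy a :=
    { le_shift X hX := by
        obtain ⟨K, rfl⟩ := X.quotient_obj_surjective
        rw [ObjectProperty.prop_shift_iff, HomotopyCategory.shift_quotient_obj]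
        exact s.complexes_shift K a hX }

instance (s : Bound) : (s.homotopy C).IsTriangulatedClosed₃ where
  ext₃' T hT h₁ h₂ := by
    obtain ⟨f : T.obj₁.as ⟶ T.obj₂.as, hf⟩ :=
      (HomotopyCategory.quotient C (.up ℤ)).map_surjective T.mor₁
    exact ⟨(HomotopyCategory.quotient C (.up ℤ)).obj (CochainComplex.mappingCone f),
      s.complexes_mappingCone f h₁ h₂,
      ⟨Triangle.π₃.mapIso (isoTriangleOfIso₁₂ T _ hT
        (HomotopyCategory.mappingCone_triangleh_distinguished f)
        (Iso.refl _) (Iso.refl _)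
        ((Category.comp_id _).trans (hf.symm.trans (Category.id_comp _).symm)))⟩⟩

instance (s : Bound) : (s.homotopy C).IsTriangulated where
  toIsTriangulatedClosed₂ := .of_isTriangulatedClosed₃

variable (C)

/-- The homotopy category `K^*(C)`, a triangulated full subcategory of `K(C)`. -/
abbrev HtpyCat (s : Bound) := (s.homotopy C).FullSubcategory

/-- The inclusion of `K^*(C)` in `K(C)`. -/
abbrev HtpyCat.ι (s : Bound) : HtpyCat C s ⥤ HomotopyCategory C (.up ℤ) := (s.homotopy C).ι

/-- The class of quasi-isomorphisms in `K^*(C)`. -/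
def HtpyCat.qis (s : Bound) : MorphismProperty (HtpyCat C s) :=
  (HomotopyCategory.quasiIso C (.up ℤ)).inverseImage (HtpyCat.ι C s)

/-- The exact complexes in `K^*(C)`. -/
abbrev HtpyCat.acyclic (s : Bound) : ObjectProperty (HtpyCat C s) :=
  (HomotopyCategory.subcategoryAcyclic C).inverseImage (HtpyCat.ι C s)

lemma HtpyCat.qis_eq_trW (s : Bound) : HtpyCat.qis C s = (HtpyCat.acyclic C s).trW := by
  ext K L f
  obtain ⟨M, g, h, hT⟩ := distinguished_cocone_triangle f
  have h₁ := (HomotopyCategory.subcategoryAcyclic C).trW_iff_of_distinguished _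
    ((HtpyCat.ι C s).map_distinguished _ hT)
  have h₂ := (HtpyCat.acyclic C s).trW_iff_of_distinguished _ hT
  rw [← HomotopyCategory.quasiIso_eq_trW_subcategoryAcyclic] at h₁
  exact h₁.trans h₂.symm

/-- The derived category `D^*(C)`: the localization of `K^*(C)` at the quasi-isomorphisms. -/
abbrev DerCat (s : Bound) := (HtpyCat.qis C s).Localization

/-- The localization functor `K^*(C) ⥤ D^*(C)`. -/
abbrev DerCat.Q (s : Bound) : HtpyCat C s ⥤ DerCat C s := (HtpyCat.qis C s).Q

/-- An object of `C` as a stalk complex (in degree `0`) in `K^*(C)`. -/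
noncomputable def HtpyCat.single (s : Bound) : C ⥤ HtpyCat C s :=
  (s.homotopy C).lift
    (HomologicalComplex.single C (.up ℤ) 0 ⋙ HomotopyCategory.quotient C (.up ℤ))
    (fun X => s.complexes_single X 0)

/-- An object of `C` as a stalk complex (in degree `0`) in `D^*(C)`. -/
noncomputable abbrev DerCat.single (s : Bound) : C ⥤ DerCat C s := HtpyCat.single C s ⋙ DerCat.Q C s

/-- The canonical (fully faithful) functor `D^*(C) ⥤ D(C)`. -/
noncomputable def DerCat.incl (s : Bound) [HasDerivedCategory.{w} C] : DerCat C s ⥤ DerivedCategory C :=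
  Localization.lift (W := HtpyCat.qis C s) (HtpyCat.ι C s ⋙ DerivedCategory.Qh)
    (fun _ _ _ hf => Localization.inverts DerivedCategory.Qh
      (HomotopyCategory.quasiIso C (.up ℤ)) _ hf) (DerCat.Q C s)

/-- The functor `D^*(C) ⥤ D(C)` is induced by the inclusion `K^*(C) ⥤ K(C)`. -/
noncomputable def DerCat.inclIso (s : Bound) [HasDerivedCategory.{w} C] :
    DerCat.Q C s ⋙ DerCat.incl C s ≅ HtpyCat.ι C s ⋙ DerivedCategory.Qh :=
  Localization.fac (W := HtpyCat.qis C s) (HtpyCat.ι C s ⋙ DerivedCategory.Qh) _ (DerCat.Q C s)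

end Complexes

section Functors

variable {C : Type u} [Category.{v} C] [Abelian C] {E : Type u'} [Category.{v'} E] [Abelian E]
  (F : Cᵒᵖ ⥤ E) [F.Additive]

/-- The extension of a contravariant functor `F` to cochain complexes:
`(F K)ⁿ = F (K⁻ⁿ)`, with differentials `F (d)`. -/
noncomputable def mapComplex : (CochainComplex C ℤ)ᵒᵖ ⥤ CochainComplex E ℤ :=
  (CochainComplex.opEquivalence C).functor ⋙ F.mapHomologicalComplex (.up ℤ)

/-- The extension of a contravariant functor `F` to the homotopy categories. -/
noncomputable def mapHomotopy : (HomotopyCategory C (.up ℤ))ᵒᵖ ⥤ HomotopyCategory E (.up ℤ) :=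
  (CategoryTheory.Quotient.lift _
    ((mapComplex F).rightOp ⋙ (HomotopyCategory.quotient E (.up ℤ)).op)
    (fun _ _ _ _ ⟨h⟩ => congrArg Quiver.Hom.op (HomotopyCategory.eq_of_homotopy _ _
      (F.mapHomotopy (CochainComplex.homotopyOp h)))) :
    HomotopyCategory C (.up ℤ) ⥤ (HomotopyCategory E (.up ℤ))ᵒᵖ).leftOp

lemma acyclic_of_iso {X Y : HomotopyCategory C (.up ℤ)} (e : X ≅ Y)
    (h : HomotopyCategory.subcategoryAcyclic E ((mapHomotopy F).obj (op X))) :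
    HomotopyCategory.subcategoryAcyclic E ((mapHomotopy F).obj (op Y)) :=
  (HomotopyCategory.subcategoryAcyclic E).prop_of_iso ((mapHomotopy F).mapIso e.symm.op) h

instance : (mapComplex F).PreservesZeroMorphisms where
  map_zero _ _ := by
    ext n
    exact F.map_zero _ _

lemma quasiIso_of_acyclic {S : ShortComplex (CochainComplex E ℤ)} (hS : S.ShortExact)
    (h₁ : S.X₁.Acyclic) : QuasiIso S.g where
  quasiIsoAt n := by
    rw [quasiIsoAt_iff_isIso_homologyMap]
    have h (i : ℤ) : IsZero (S.X₁.homology i) := (h₁ i).isZero_homology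
    have : Mono (HomologicalComplex.homologyMap S.g n) :=
      (hS.homology_exact₂ n).mono_g ((h n).eq_of_src _ _)
    have : Epi (HomologicalComplex.homologyMap S.g n) :=
      (hS.homology_exact₃ n (n + 1) rfl).epi_f ((h (n + 1)).eq_of_tgt _ _)
    exact isIso_of_mono_of_epi _

lemma quasiIso_mapComplex (S : ShortComplex (CochainComplex C ℤ))
    (σ : ∀ n : ℤ, (S.map (HomologicalComplex.eval _ _ n)).Splitting)
    (h : ((mapComplex F).obj (op S.X₃)).Acyclic) : QuasiIso ((mapComplex F).map S.f.op) := by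
  have hS : (S.op.map (mapComplex F)).ShortExact := by
    refine HomologicalComplex.shortExact_of_degreewise_shortExact _ (fun n => ?_)
    exact ((σ (-n)).op.map F).shortExact
  exact quasiIso_of_acyclic hS h

lemma quasiIso_mapHomotopy (T : Triangle (HomotopyCategory C (.up ℤ)))
    (hT : T ∈ distTriang (HomotopyCategory C (.up ℤ)))
    (h : HomotopyCategory.subcategoryAcyclic E ((mapHomotopy F).obj (op T.obj₃))) :
    HomotopyCategory.quasiIso E (.up ℤ) ((mapHomotopy F).map T.mor₁.op) := by
  obtain ⟨g : (T.obj₃⟦(-1 : ℤ)⟧).as ⟶ T.obj₁.as, hg⟩ :=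
    (HomotopyCategory.quotient C (.up ℤ)).map_surjective T.invRotate.mor₁
  let e := isoTriangleOfIso₁₂ _ _ (inv_rot_of_distTriang _ hT)
    (HomotopyCategory.mappingCone_triangleh_distinguished g) (Iso.refl _) (Iso.refl _)
    ((Category.comp_id _).trans (hg.symm.trans (Category.id_comp _).symm))
  have h₃ : ((mapComplex F).obj
      (op (CochainComplex.mappingCone.triangleRotateShortComplex g).X₃)).Acyclic := by
    rw [← HomotopyCategory.quotient_obj_mem_subcategoryAcyclic_iff_acyclic]
    let e₁ : T.obj₃ ≅ (HomotopyCategory.quotient C (.up ℤ)).obj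
        ((T.obj₃⟦(-1 : ℤ)⟧).as⟦(1 : ℤ)⟧) :=
      (shiftFunctorCompIsoId _ (-1 : ℤ) 1 (by simp)).symm.app T.obj₃ ≪≫
        ((HomotopyCategory.quotient C (.up ℤ)).commShiftIso (1 : ℤ)).symm.app
          (T.obj₃⟦(-1 : ℤ)⟧).as
    exact acyclic_of_iso F e₁ h
  have h₄ : HomotopyCategory.quasiIso E (.up ℤ)
      ((HomotopyCategory.quotient E (.up ℤ)).map ((mapComplex F).map
        (CochainComplex.mappingCone.triangleRotateShortComplex g).f.op)) := by
    rw [HomotopyCategory.quotient_map_mem_quasiIso_iff]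
    exact quasiIso_mapComplex F _
      (CochainComplex.mappingCone.triangleRotateShortComplexSplitting g) h₃
  refine ((HomotopyCategory.quasiIso E (.up ℤ)).arrow_mk_iso_iff ?_).1 h₄
  have he : T.mor₁ ≫ e.hom.hom₃ = (HomotopyCategory.quotient C (.up ℤ)).map
      (CochainComplex.mappingCone.triangleRotateShortComplex g).f :=
    e.hom.comm₂.trans (Category.id_comp _)
  refine Arrow.isoMk ((mapHomotopy F).mapIso (Triangle.π₃.mapIso e).op) (Iso.refl _) ?_
  refine Eq.trans ?_ (Category.comp_id _).symm
  exact ((mapHomotopy F).map_comp _ _).symm.trans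
    (congrArg (fun k => (mapHomotopy F).map (Quiver.Hom.op k)) he)

/-- The restriction of `F : K(C)ᵒᵖ ⥤ K(E)` to `K^*(C)`. -/
noncomputable abbrev mapHtpyCat (s : Bound) : (HtpyCat C s)ᵒᵖ ⥤ HomotopyCategory E (.up ℤ) :=
  (HtpyCat.ι C s).op ⋙ mapHomotopy F

/-- The functor `F` sends complexes in `K^s(C)` to complexes in `K^t(E)`. -/
def MapsBound (s t : Bound) : Prop :=
  ∀ K : CochainComplex C ℤ, s.complexes C K → t.complexes E ((mapComplex F).obj (op K))

variable {F} in
/-- The functor `K^s(C)ᵒᵖ ⥤ K^t(E)` induced by `F`. -/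
noncomputable abbrev MapsBound.functor {s t : Bound} (h : MapsBound F s t) :
    (HtpyCat C s)ᵒᵖ ⥤ HtpyCat E t :=
  (t.homotopy E).lift (mapHtpyCat F s) (fun X => h X.unop.obj.as X.unop.property)

/-- A triangulated subcategory `P` of `K^s(C)` is adapted to the contravariant functor `F` if
every complex `X` in `K^s(C)` is the target of a quasi-isomorphism `Y ⟶ X` with `Y` in `P`, and
`F` sends the exact complexes in `P` to exact complexes. (As `F` is contravariant, `Y ⟶ X` is, in
`K^s(C)ᵒᵖ`, a quasi-isomorphism from `X` into an object of `P`.) -/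
structure IsAdapted (s : Bound) (P : ObjectProperty (HtpyCat C s)) : Prop where
  isTriangulated : P.IsTriangulated
  exists_resolution (X : HtpyCat C s) : ∃ (Y : HtpyCat C s) (f : Y ⟶ X), P Y ∧ HtpyCat.qis C s f
  acyclic (Y : HtpyCat C s) (hY : P Y)
    (h : HomotopyCategory.subcategoryAcyclic C Y.obj) :
    HomotopyCategory.subcategoryAcyclic E ((mapHtpyCat F s).obj (op Y))

/-- There is a triangulated subcategory of `K^s(C)` that is adapted to `F`. -/
class HasAdaptedSubcategory (s : Bound) : Prop where
  exists_isAdapted : ∃ P : ObjectProperty (HtpyCat C s), IsAdapted F s P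

variable {F} in
lemma IsAdapted.quasiIso_map {s : Bound} {P : ObjectProperty (HtpyCat C s)} (hP : IsAdapted F s P)
    {X Y : HtpyCat C s} (f : X ⟶ Y) (hX : P X) (hY : P Y) (hf : HtpyCat.qis C s f) :
    HomotopyCategory.quasiIso E (.up ℤ) ((mapHtpyCat F s).map f.op) := by
  have := hP.isTriangulated
  obtain ⟨Z, hZ, g, h, hT⟩ := P.distinguished_cocone_triangle f hX hY
  rw [HtpyCat.qis_eq_trW] at hf
  exact quasiIso_mapHomotopy F _ ((HtpyCat.ι C s).map_distinguished _ hT)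
    (hP.acyclic Z hZ (((HtpyCat.acyclic C s).trW_iff_of_distinguished _ hT).1 hf))

variable {F} in
lemma IsAdapted.hasDerived {s : Bound} {P : ObjectProperty (HtpyCat C s)} (hP : IsAdapted F s P)
    {H : Type*} [Category* H] (G : (HtpyCat C s)ᵒᵖ ⥤ H)
    (hG : ∀ ⦃X Y : HtpyCat C s⦄ (f : X ⟶ Y),
      HomotopyCategory.quasiIso E (.up ℤ) ((mapHtpyCat F s).map f.op) → IsIso (G.map f.op)) :
    G.HasPointwiseRightDerivedFunctor (HtpyCat.qis C s).op := by
  have := hP.isTriangulated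
  exact hasPointwiseRightDerivedFunctor (P := P) _ (HtpyCat.qis_eq_trW C s) hP.exists_resolution G
    (fun X Y f hX hY hf => hG f (hP.quasiIso_map f hX hY hf))

lemma isIso_Qh_map {X Y : HomotopyCategory E (.up ℤ)} [HasDerivedCategory.{w} E] (f : X ⟶ Y)
    (hf : HomotopyCategory.quasiIso E (.up ℤ) f) : IsIso (DerivedCategory.Qh.map f) :=
  Localization.inverts DerivedCategory.Qh (HomotopyCategory.quasiIso E (.up ℤ)) _ hf

instance [HasDerivedCategory.{w} E] (s : Bound) [hF : HasAdaptedSubcategory F s] :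
    (mapHtpyCat F s ⋙ DerivedCategory.Qh).HasPointwiseRightDerivedFunctor (HtpyCat.qis C s).op := by
  obtain ⟨P, hP⟩ := hF.exists_isAdapted
  exact hP.hasDerived _ (fun _ _ _ hf => isIso_Qh_map _ hf)

variable {F} in
lemma MapsBound.hasDerived {s t : Bound} (h : MapsBound F s t) [hF : HasAdaptedSubcategory F s] :
    (h.functor ⋙ DerCat.Q E t).HasPointwiseRightDerivedFunctor (HtpyCat.qis C s).op := by
  obtain ⟨P, hP⟩ := hF.exists_isAdapted
  exact hP.hasDerived _ (fun _ _ _ hf => Localization.inverts (DerCat.Q E t) (HtpyCat.qis E t) _ hf)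

/-- The total right derived functor `R^s F : D^s(C)ᵒᵖ ⥤ D(E)` of `F`: the left Kan extension of
`K^s(C)ᵒᵖ ⥤ K(E) ⥤ D(E)` along `K^s(C)ᵒᵖ ⥤ D^s(C)ᵒᵖ`. -/
noncomputable def rightDerived [HasDerivedCategory.{w} E] (s : Bound) [HasAdaptedSubcategory F s] :
    (DerCat C s)ᵒᵖ ⥤ DerivedCategory E :=
  (mapHtpyCat F s ⋙ DerivedCategory.Qh).totalRightDerived (DerCat.Q C s).op (HtpyCat.qis C s).op

/-- The universal natural transformation `F K ⟶ (R^s F) K` for `K` in `K^s(C)`. -/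
noncomputable def rightDerivedUnit [HasDerivedCategory.{w} E] (s : Bound) [HasAdaptedSubcategory F s] :
    mapHtpyCat F s ⋙ DerivedCategory.Qh ⟶ (DerCat.Q C s).op ⋙ rightDerived F s :=
  (mapHtpyCat F s ⋙ DerivedCategory.Qh).totalRightDerivedUnit (DerCat.Q C s).op (HtpyCat.qis C s).op

instance [HasDerivedCategory.{w} E] (s : Bound) [HasAdaptedSubcategory F s] :
   (rightDerived F s).IsRightDerivedFunctor (rightDerivedUnit F s) (HtpyCat.qis C s).op := by
  dsimp only [rightDerived, rightDerivedUnit]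
  infer_instance

variable {F} in
/-- The total right derived functor of `F` with values in `D^t(E)`, when `F` sends `K^s(C)` to
`K^t(E)`: the left Kan extension of `K^s(C)ᵒᵖ ⥤ K^t(E) ⥤ D^t(E)` along `K^s(C)ᵒᵖ ⥤ D^s(C)ᵒᵖ`. It is
`rightDerived F s`, regarded as a functor to `D^t(E)`, see `MapsBound.rightDerivedCompIncl`. -/
noncomputable def MapsBound.rightDerived {s t : Bound} (h : MapsBound F s t) [HasAdaptedSubcategory F s] :
    (DerCat C s)ᵒᵖ ⥤ DerCat E t :=
  have := h.hasDerived
  (h.functor ⋙ DerCat.Q E t).totalRightDerived (DerCat.Q C s).op (HtpyCat.qis C s).op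

variable {F} in
/-- The universal natural transformation attached to `MapsBound.rightDerived`. -/
noncomputable def MapsBound.rightDerivedUnit {s t : Bound} (h : MapsBound F s t) [HasAdaptedSubcategory F s] :
    h.functor ⋙ DerCat.Q E t ⟶ (DerCat.Q C s).op ⋙ h.rightDerived :=
  have := h.hasDerived
  (h.functor ⋙ DerCat.Q E t).totalRightDerivedUnit (DerCat.Q C s).op (HtpyCat.qis C s).op

instance {s t : Bound} (h : MapsBound F s t) [HasAdaptedSubcategory F s] :
    h.rightDerived.IsRightDerivedFunctor h.rightDerivedUnit (HtpyCat.qis C s).op := by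
  have := h.hasDerived
  dsimp only [MapsBound.rightDerived, MapsBound.rightDerivedUnit]
  infer_instance

variable {F} in
/-- The functor `h.rightDerived`, followed by `D^t(E) ⥤ D(E)`, is `rightDerived F s`. -/
noncomputable def MapsBound.rightDerivedCompIncl [HasDerivedCategory.{w} E] {s t : Bound}
    (h : MapsBound F s t) [HasAdaptedSubcategory F s] :
    h.rightDerived ⋙ DerCat.incl E t ≅ DerivedReflexive.rightDerived F s :=
  let α : mapHtpyCat F s ⋙ DerivedCategory.Qh ⟶
      (DerCat.Q C s).op ⋙ h.rightDerived ⋙ DerCat.incl E t :=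
    Functor.whiskerLeft h.functor (DerCat.inclIso E t).inv ≫
      Functor.whiskerRight h.rightDerivedUnit (DerCat.incl E t)
  have : (h.rightDerived ⋙ DerCat.incl E t).IsRightDerivedFunctor α (HtpyCat.qis C s).op := by
    obtain ⟨P, hP⟩ := HasAdaptedSubcategory.exists_isAdapted (F := F) (s := s)
    have := hP.isTriangulated
    refine isRightDerivedFunctor_of_isIso (P := P) _ (HtpyCat.qis_eq_trW C s) hP.exists_resolution _
      (fun X Y f hX hY hf => isIso_Qh_map _ (hP.quasiIso_map f hX hY hf)) _ _ (fun X hX => ?_)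
    have := isIso_of_isRightDerivedFunctor (P := P) _ (HtpyCat.qis_eq_trW C s) hP.exists_resolution
      (h.functor ⋙ DerCat.Q E t) (fun _ _ f hX hY hf => Localization.inverts (DerCat.Q E t)
        (HtpyCat.qis E t) _ (hP.quasiIso_map f hX hY hf)) h.rightDerived h.rightDerivedUnit X hX
    have : IsIso ((DerCat.incl E t).map (h.rightDerivedUnit.app (op X))) := Functor.map_isIso _ _
    exact IsIso.comp_isIso' inferInstance this
  Functor.rightDerivedUnique _ _ α (DerivedReflexive.rightDerivedUnit F s) (HtpyCat.qis C s).op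

/-- An object `X` of `C` is `F`-acyclic if `Hⁱ(RF X) = 0` for all `i ≠ 0`. -/
def IsAcyclicObject (s : Bound) [HasAdaptedSubcategory F s] [HasDerivedCategory.{w} E] (X : C) :
    Prop :=
  ∀ i : ℤ, i ≠ 0 → IsZero ((DerivedCategory.homologyFunctor E i).obj
    ((rightDerived F s).obj (op ((DerCat.single C s).obj X))))

end Functors

section Unit

variable {A : Type u} [Category.{v} A] [Abelian A] {B : Type u'} [Category.{v'} B] [Abelian B]
  {Φ : Aᵒᵖ ⥤ B} {Ψ : Bᵒᵖ ⥤ A} [Φ.Additive] [Ψ.Additive] (adj : Φ.rightOp ⊣ Ψ)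

/-- The unit `η` extended term by term to complexes: `K ⟶ Ψ Φ K`. -/
noncomputable def complexUnit :
    𝟭 (CochainComplex A ℤ) ⟶ (mapComplex Φ).rightOp ⋙ mapComplex Ψ where
  app K :=
    { f := fun n => (K.XIsoOfEq (neg_neg n)).inv ≫ adj.unit.app (K.X (- -n))
      comm' := by
        intro i j _
        have h : ((K.XIsoOfEq (neg_neg i)).inv ≫ adj.unit.app (K.X (- -i))) ≫
            (Φ.rightOp ⋙ Ψ).map (K.d (- -i) (- -j)) =
              K.d i j ≫ (K.XIsoOfEq (neg_neg j)).inv ≫ adj.unit.app (K.X (- -j)) := by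
          rw [Category.assoc, ← adj.unit.naturality, Functor.id_map,
            HomologicalComplex.XIsoOfEq_inv_comp_d_assoc,
            HomologicalComplex.d_comp_XIsoOfEq_inv_assoc]
        exact h }
  naturality K L f := by
    ext n
    have h : f.f n ≫ (L.XIsoOfEq (neg_neg n)).inv ≫ adj.unit.app (L.X (- -n)) =
        ((K.XIsoOfEq (neg_neg n)).inv ≫ adj.unit.app (K.X (- -n))) ≫
          (Φ.rightOp ⋙ Ψ).map (f.f (- -n)) := by
      rw [Category.assoc, ← adj.unit.naturality, Functor.id_map,
        HomologicalComplex.XIsoOfEq_inv_naturality_assoc]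
    exact h

/-- The unit `η` extended to the homotopy category. -/
noncomputable def homotopyUnit :
    𝟭 (HomotopyCategory A (.up ℤ)) ⟶ (mapHomotopy Φ).rightOp ⋙ mapHomotopy Ψ where
  app X := (HomotopyCategory.quotient A (.up ℤ)).map ((complexUnit adj).app X.as)
  naturality := by
    rintro ⟨K⟩ ⟨L⟩ f
    obtain ⟨f, rfl⟩ := (HomotopyCategory.quotient A (.up ℤ)).map_surjective f
    exact congrArg (HomotopyCategory.quotient A (.up ℤ)).map ((complexUnit adj).naturality f)

variable {s t : Bound} (h : MapsBound Φ s t) [HasAdaptedSubcategory Φ s] [HasAdaptedSubcategory Ψ t]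
  [HasDerivedCategory.{w} A]

/-- For `X` in `K^s(A)`, the morphism `X ⟶ Ψ Φ X ⟶ (RΨ) (Φ X)` of `D(A)` (here in `D(A)ᵒᵖ`). -/
noncomputable def preUnit : h.functor ⋙ DerCat.Q B t ⋙ (rightDerived Ψ t).rightOp ⟶
    (DerCat.Q A s).op ⋙ (DerCat.incl A s).op where
  app X := ((DerCat.inclIso A s).hom.app X.unop ≫
    DerivedCategory.Qh.map ((homotopyUnit adj).app X.unop.obj) ≫
    (rightDerivedUnit Ψ t).app (op (h.functor.obj X))).op
  naturality X Y f := by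
    apply Quiver.Hom.unop_inj
    have h₁ := (DerCat.inclIso A s).hom.naturality f.unop
    have h₂ := congrArg DerivedCategory.Qh.map ((homotopyUnit adj).naturality f.unop.hom)
    have h₃ := (rightDerivedUnit Ψ t).naturality (h.functor.map f).op
    rw [Functor.map_comp, Functor.map_comp] at h₂
    change (_ ≫ _ ≫ _) ≫ (rightDerived Ψ t).map ((DerCat.Q B t).map (h.functor.map f)).op =
      (DerCat.incl A s).map ((DerCat.Q A s).map f.unop) ≫ _ ≫ _ ≫ _
    simp only [Category.assoc]
    exact (((_ ≫= (_ ≫= h₃.symm)).trans (_ ≫= ((Category.assoc _ _ _).symm.trans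
      ((h₂.symm =≫ _).trans (Category.assoc _ _ _))))).trans
        ((Category.assoc _ _ _).symm.trans ((h₁.symm =≫ _).trans (Category.assoc _ _ _))))

/-- The natural transformation exhibiting `RΨ ∘ RΦ` as the derived functor of `RΨ ∘ Φ`. -/
noncomputable def compUnit : h.functor ⋙ DerCat.Q B t ⋙ (rightDerived Ψ t).rightOp ⟶
    (DerCat.Q A s).op ⋙ h.rightDerived ⋙ (rightDerived Ψ t).rightOp :=
  Functor.whiskerRight h.rightDerivedUnit (rightDerived Ψ t).rightOp

instance : (h.rightDerived ⋙ (rightDerived Ψ t).rightOp).IsRightDerivedFunctor (compUnit (Ψ := Ψ) h) (HtpyCat.qis A s).op := by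
  obtain ⟨P, hP⟩ := HasAdaptedSubcategory.exists_isAdapted (F := Φ) (s := s)
  have := hP.isTriangulated
  refine isRightDerivedFunctor_of_isIso (P := P) _ (HtpyCat.qis_eq_trW A s) hP.exists_resolution _
    (fun X Y f hX hY hf => ?_) _ _ (fun X hX => ?_)
  · have : IsIso ((DerCat.Q B t).map (h.functor.map f.op)) :=
      Localization.inverts (DerCat.Q B t) (HtpyCat.qis B t) _ (hP.quasiIso_map f hX hY hf)
    exact Functor.map_isIso (rightDerived Ψ t).rightOp _
  · have := isIso_of_isRightDerivedFunctor (P := P) _ (HtpyCat.qis_eq_trW A s) hP.exists_resolution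
      (h.functor ⋙ DerCat.Q B t) (fun _ _ f hX hY hf => Localization.inverts (DerCat.Q B t)
        (HtpyCat.qis B t) _ (hP.quasiIso_map f hX hY hf)) h.rightDerived h.rightDerivedUnit X hX
    exact Functor.map_isIso (rightDerived Ψ t).rightOp _

/-- The derived unit `η̂_X : X ⟶ (RΨ) (RΦ X)`, natural in `X` in `D^s(A)`. It is the only natural
transformation that is compatible with `η` in the sense of `derivedUnit_fac`, i.e. the unit of the
adjunction between the derived functors that is inherited from `η`. -/
noncomputable def derivedUnit : DerCat.incl A s ⟶ h.rightDerived.rightOp ⋙ rightDerived Ψ t where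
  app X := (((h.rightDerived ⋙ (rightDerived Ψ t).rightOp).rightDerivedDesc (compUnit h) (HtpyCat.qis A s).op _
    (preUnit adj h)).app (op X)).unop
  naturality X Y f := Quiver.Hom.op_inj
    (((h.rightDerived ⋙ (rightDerived Ψ t).rightOp).rightDerivedDesc (compUnit h) (HtpyCat.qis A s).op _
    (preUnit adj h)).naturality f.op).symm

lemma derivedUnit_fac (X : HtpyCat A s) :
    (derivedUnit adj h).app ((DerCat.Q A s).obj X) ≫ (rightDerived Ψ t).map (h.rightDerivedUnit.app (op X)).op =
      (DerCat.inclIso A s).hom.app X ≫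
        DerivedCategory.Qh.map ((homotopyUnit adj).app X.obj) ≫
          (rightDerivedUnit Ψ t).app (op (h.functor.obj (op X))) :=
  Quiver.Hom.op_inj ((h.rightDerived ⋙ (rightDerived Ψ t).rightOp).rightDerived_fac_app (compUnit h)
    (HtpyCat.qis A s).op _ (preUnit adj h) (op X))

/-- An object `X` of `A` is `D`-reflexive if `η̂_X` is an isomorphism for the stalk complex `X`. -/
def IsDReflexive (X : A) : Prop :=
  IsIso ((derivedUnit adj h).app ((DerCat.single A s).obj X))

end Unit

section Dimension

variable {A : Type u} [Category.{v} A] [Abelian A]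

/-- The class `𝓕` of objects gives `M` a left dimension `≤ α`: there is an exact sequence
`⋯ ⟶ F₁ ⟶ F₀ ⟶ M ⟶ 0` with each `Fᵢ` in `𝓕` or zero, and with `Fᵢ = 0` for `i > α`. -/
def LeftDimLE (𝓕 : ObjectProperty A) (M : A) (α : ℕ∞) : Prop :=
  ∃ (F : ChainComplex A ℕ) (ε : F.X 0 ⟶ M) (w : F.d 1 0 ≫ ε = 0),
    Epi ε ∧ (ShortComplex.mk (F.d 1 0) ε w).Exact ∧ (∀ i : ℕ, F.ExactAt (i + 1)) ∧
      (∀ i : ℕ, 𝓕 (F.X i) ∨ IsZero (F.X i)) ∧ ∀ i : ℕ, α < (i : ℕ∞) → IsZero (F.X i)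

/-- `M` has finite left `𝓕`-dimension. -/
def HasFiniteLeftDim (𝓕 : ObjectProperty A) (M : A) : Prop :=
  ∃ n : ℕ, LeftDimLE 𝓕 M (n : ℕ∞)

/-- The class `𝓖_{ΦΨ}` of the objects `X` that are `Φ`-acyclic, with `Φ X` being `Ψ`-acyclic,
and such that the unit `η_X : X ⟶ Ψ Φ X` is an isomorphism. -/
structure GorensteinClass {B : Type u'} [Category.{v'} B] [Abelian B]
    {Φ : Aᵒᵖ ⥤ B} {Ψ : Bᵒᵖ ⥤ A} [Φ.Additive] [Ψ.Additive] (adj : Φ.rightOp ⊣ Ψ) (s t : Bound)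
    [HasAdaptedSubcategory Φ s] [HasAdaptedSubcategory Ψ t]
    [HasDerivedCategory.{w} A] [HasDerivedCategory.{w'} B] (X : A) : Prop where
  acyclic : IsAcyclicObject Φ s X
  acyclic_map : IsAcyclicObject Ψ t (Φ.obj (op X))
  isIso_unit : IsIso (adj.unit.app X)

end Dimension

end DerivedReflexive

/-! A finite resolution of `X` by objects of the class `GorensteinClass`, read as a bounded complex
`K`, is isomorphic to `X` in the derived category, so it suffices that the derived unit is
invertible at `K`. Every term of `K` is `Φ`-acyclic, every term of `Φ K` is `Ψ`-acyclic, and `η` is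
invertible in each degree. If `RΦ K` is computed by `Φ K` and `RΨ (Φ K)` by `Ψ Φ K`, then all the
other arrows of `derivedUnit_fac` at `K` are isomorphisms, hence so is the derived unit
(`isIso_derivedUnit_app`).

The substance is that bounded complexes of acyclic objects compute the derived functor, although
they need not lie in the given adapted subcategory `P`. Therefore `P` is enlarged to `computing`:
the extensions of a complex killed by both localization and `F` by a complex of `P`. The derived
functor is still computed by `F` there (`isIso_of_computing`), and the enlargement is triangulated
(`isTriangulated_computing`). It contains the stalks of acyclic objects (`computing_single`),
because `F`, being part of an adjoint pair, is left exact. Peeling off one degree at a time then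
gives all bounded complexes with acyclic terms (`HtpyCat.prop_of_bounded`). -/

namespace DerivedReflexive

/-! ### Extension products of triangulated subcategories. -/

section ExtensionProduct

open ObjectProperty

variable {T : Type u} [Category.{v} T] [HasZeroObject T] [HasShift T ℤ] [Preadditive T]
  [∀ n : ℤ, (shiftFunctor T n).Additive] [Pretriangulated T] [IsTriangulated T]
  {B P W : ObjectProperty T} [B.IsTriangulated] [P.IsTriangulated] [W.IsTriangulated]
  [B.IsClosedUnderIsomorphisms] [W.IsClosedUnderIsomorphisms]

/-- Given `Z ⟶ K ⟶ Q` with `Z` in `W` and `Q` in `P`, resolve `K` by `p : Y ⟶ K` with cone `V` in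
`B`. The octahedron on `Y ⟶ K ⟶ Q` gives a triangle `V ⟶ U ⟶ Z⟦1⟧`, where `U` is the cone of the
composite. It puts `U` in `B`; as a cone between objects of `P`, `U` is also in `P` up to
isomorphism, hence in `W`. The same triangle then puts `V` in `W`. -/
lemma extensionProduct_le_swap (hWB : W ≤ B) (hPB : P ⊓ B ≤ W)
    (hres : ∀ X : T, ∃ (Y : T) (f : Y ⟶ X), P Y ∧ B.trW f) :
    extensionProduct W P ≤ extensionProduct P W := by
  rintro K ⟨Z, Q, f, g, k, hT, hZ, hQ⟩
  obtain ⟨Y, p, hY, V, a, b, hp, hV⟩ := hres K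
  obtain ⟨U, c, d, hU⟩ := distinguished_cocone_triangle (p ≫ g)
  have hO := (Triangulated.someOctahedron rfl hp (rot_of_distTriang _ hT) hU).mem
  have hUB : B U := B.ext_of_isTriangulatedClosed₂ _ hO hV (B.le_shift (1 : ℤ) _ (hWB _ hZ))
  obtain ⟨U', hU', ⟨e⟩⟩ := P.ext_of_isTriangulatedClosed₃' _ hU hY hQ
  have hUW : W U := W.prop_of_iso e.symm (hPB _ ⟨hU', B.prop_of_iso e hUB⟩)
  exact ⟨Y, V, p, a, b, hp, hY,
    W.ext_of_isTriangulatedClosed₁ _ hO hUW (W.le_shift (1 : ℤ) _ hZ)⟩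

/-- Writing `*` for the extension product, which is associative, closure under extensions is `(P *
W) * (P * W) = P * (W * P) * W ≤ P * (P * W) * W = (P * P) * (W * W) ≤ P * W`, where the first
inequality is the swap. Since `P` need not be closed under isomorphisms, `P * P` only lands in its
isomorphism closure, which the extension product does not see. -/
lemma isTriangulated_extensionProduct (hWB : W ≤ B) (hPB : P ⊓ B ≤ W)
    (hres : ∀ X : T, ∃ (Y : T) (f : Y ⟶ X), P Y ∧ B.trW f) :
    (extensionProduct P W).IsTriangulated where
  toContainsZero := by
    obtain ⟨X, hX, hX'⟩ := P.exists_prop_of_containsZero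
    exact ⟨X, hX, le_extensionProduct_left W _ hX'⟩
  toIsTriangulatedClosed₂ := .mk' (fun S hS h₁ h₃ => by
    have h : extensionProduct (extensionProduct P W) (extensionProduct P W) S.obj₂ :=
      ⟨_, _, _, _, _, hS, h₁, h₃⟩
    rw [extensionProduct_assoc, ← extensionProduct_assoc W P W] at h
    have h' := monotone_extensionProduct_right P
      (monotone_extensionProduct_left W (extensionProduct_le_swap hWB hPB hres)) _ h
    rw [extensionProduct_assoc, ← extensionProduct_assoc P P] at h'
    have h'' := monotone_extensionProduct_right _
      (extensionProduct_le_of_isTriangulatedClosed₂ (le_refl W) le_rfl) _ h'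
    have h₄ := monotone_extensionProduct_left _
      (extensionProduct_le_of_isTriangulatedClosed₂' (le_refl P) le_rfl) _ h''
    rwa [extensionProduct_isoClosure_left] at h₄)

end ExtensionProduct

/-! ### Contravariant functors and distinguished triangles. -/

section Contravariant

variable {C : Type u} [Category.{v} C] [Abelian C] {E : Type u'} [Category.{v'} E] [Abelian E]
  (F : Cᵒᵖ ⥤ E) [F.Additive]

lemma acyclic_iff_quasiIso {S : ShortComplex (CochainComplex E ℤ)} (hS : S.ShortExact) :
    S.X₁.Acyclic ↔ QuasiIso S.g := by
  refine ⟨quasiIso_of_acyclic hS, fun h n => ?_⟩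
  rw [HomologicalComplex.exactAt_iff_isZero_homology]
  have h₁ (i : ℤ) : IsIso (HomologicalComplex.homologyMap S.g i) := inferInstance
  have hδ : hS.δ (n - 1) n (by simp) = 0 := by
    rw [← cancel_epi (HomologicalComplex.homologyMap S.g (n - 1)), comp_zero, hS.comp_δ]
  have hf : HomologicalComplex.homologyMap S.f n = 0 := by
    rw [← cancel_mono (HomologicalComplex.homologyMap S.g n), zero_comp,
      ← HomologicalComplex.homologyMap_comp, S.zero, HomologicalComplex.homologyMap_zero]
  exact (hS.homology_exact₁ (n - 1) n (by simp)).isZero_of_both_zeros hδ hf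

/-- Up to isomorphism the triangle comes from a degreewise split short exact sequence; an additive
functor keeps it degreewise split, so the long exact homology sequence applies to its image. -/
lemma acyclic_iff_quasiIso_mapHomotopy (T : Triangle (HomotopyCategory C (.up ℤ)))
    (hT : T ∈ distTriang (HomotopyCategory C (.up ℤ))) :
    HomotopyCategory.subcategoryAcyclic E ((mapHomotopy F).obj (op T.obj₃)) ↔
      HomotopyCategory.quasiIso E (.up ℤ) ((mapHomotopy F).map T.mor₁.op) := by
  obtain ⟨S, σ, ⟨e⟩⟩ := (HomotopyCategory.distinguished_iff_iso_trianglehOfDegreewiseSplit T).1 hT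
  have hS : (S.op.map (mapComplex F)).ShortExact :=
    HomologicalComplex.shortExact_of_degreewise_shortExact _
      (fun n => ((σ (-n)).op.map F).shortExact)
  have h₃ := (HomotopyCategory.subcategoryAcyclic E).prop_iff_of_iso
    ((mapHomotopy F).mapIso (Triangle.π₃.mapIso e).symm.op)
  have h₁ := (HomotopyCategory.quasiIso E (.up ℤ)).arrow_mk_iso_iff
    (Arrow.isoMk ((mapHomotopy F).mapIso (Triangle.π₂.mapIso e).symm.op)
      ((mapHomotopy F).mapIso (Triangle.π₁.mapIso e).symm.op)
      (by
        change (mapHomotopy F).map _ ≫ (mapHomotopy F).map _ =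
          (mapHomotopy F).map _ ≫ (mapHomotopy F).map _
        rw [← Functor.map_comp, ← Functor.map_comp]
        exact congrArg (fun f => (mapHomotopy F).map (Quiver.Hom.op f)) e.inv.comm₁) :
      Arrow.mk ((mapHomotopy F).map T.mor₁.op) ≅
        Arrow.mk ((mapHomotopy F).map ((HomotopyCategory.quotient C (.up ℤ)).map S.f).op))
  rw [h₁]
  refine h₃.trans ?_
  change HomotopyCategory.subcategoryAcyclic E
    ((HomotopyCategory.quotient E (.up ℤ)).obj ((mapComplex F).obj (op S.X₃))) ↔
      HomotopyCategory.quasiIso E (.up ℤ)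
        ((HomotopyCategory.quotient E (.up ℤ)).map ((mapComplex F).map S.f.op))
  rw [HomotopyCategory.quotient_obj_mem_subcategoryAcyclic_iff_acyclic,
    HomotopyCategory.quotient_map_mem_quasiIso_iff]
  exact acyclic_iff_quasiIso hS

/-- The complexes that `F` sends to exact complexes. -/
def kernelProperty : ObjectProperty (HomotopyCategory C (.up ℤ)) := fun X =>
  HomotopyCategory.subcategoryAcyclic E ((mapHomotopy F).obj (op X))

instance : (kernelProperty F).IsClosedUnderIsomorphisms where
  of_iso e h := acyclic_of_iso F e h

/-- `F (K⟦a⟧)` is `(F K)⟦-a⟧`. -/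
noncomputable def mapComplexShiftIso (K : CochainComplex C ℤ) (a : ℤ) :
    ((mapComplex F).obj (op K))⟦-a⟧ ≅ (mapComplex F).obj (op (K⟦a⟧)) :=
  HomologicalComplex.Hom.isoOfComponents
    (fun n => F.mapIso (K.XIsoOfEq (by lia : -n + a = -(n + -a))).op)
    (fun i j _ => by
      change F.map (K.XIsoOfEq _).hom.op ≫ F.map (a.negOnePow • K.d (-j + a) (-i + a)).op =
        ((-a).negOnePow • F.map (K.d (-(j + -a)) (-(i + -a))).op) ≫ F.map (K.XIsoOfEq _).hom.op
      have h : F.map (a.negOnePow • K.d (-j + a) (-i + a)).op =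
          a.negOnePow • F.map (K.d (-j + a) (-i + a)).op := by
        obtain h | h := Int.units_eq_one_or a.negOnePow <;> simp [h]
      -- The two shifts contribute the signs `(-1)^a` and `(-1)^(-a)`, which agree, so the
      -- reindexing isomorphisms need no sign correction.
      rw [Int.negOnePow_neg, h, Linear.comp_units_smul, Linear.units_smul_comp,
        ← F.map_comp, ← F.map_comp, ← op_comp, ← op_comp,
        HomologicalComplex.d_comp_XIsoOfEq_hom, HomologicalComplex.XIsoOfEq_hom_comp_d])

instance : (kernelProperty F).IsTriangulated where
  exists_zero := ⟨(HomotopyCategory.quotient _ _).obj HomologicalComplex.zero,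
    Functor.map_isZero _ HomologicalComplex.isZero_zero, by
      refine (HomotopyCategory.quotient_obj_mem_subcategoryAcyclic_iff_exactAt _).2 (fun n => ?_)
      exact ShortComplex.exact_of_isZero_X₂ _ (F.map_isZero (isZero_zero C).op)⟩
  isStableUnderShiftBy a := ⟨fun X hX => by
    obtain ⟨K, rfl⟩ := X.quotient_obj_surjective
    have h := (HomotopyCategory.subcategoryAcyclic E).le_shift (-a) _ hX
    exact acyclic_of_iso F ((HomotopyCategory.quotient C (.up ℤ)).commShiftIso a |>.app K)
      ((HomotopyCategory.subcategoryAcyclic E).prop_of_iso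
        (((HomotopyCategory.quotient E (.up ℤ)).commShiftIso (-a)).symm.app _ ≪≫
          (HomotopyCategory.quotient E (.up ℤ)).mapIso (mapComplexShiftIso F K a)) h)⟩
  toIsTriangulatedClosed₂ := .mk' (fun T hT h₁ h₃ => by
    have h := (acyclic_iff_quasiIso_mapHomotopy F T hT).1 h₃
    rw [kernelProperty, HomotopyCategory.mem_subcategoryAcyclic_iff] at h₁ ⊢
    intro n
    have := h n
    exact (h₁ n).of_iso (asIso ((HomotopyCategory.homologyFunctor E (.up ℤ) n).map
      ((mapHomotopy F).map T.mor₁.op))))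

end Contravariant

/-! ### Complexes on which the derived functor is computed by the functor itself. -/

section Adapted

variable {C : Type u} [Category.{v} C] [Abelian C] {E : Type u'} [Category.{v'} E] [Abelian E]
  (F : Cᵒᵖ ⥤ E) [F.Additive]

/-- The exact complexes in `K^s(C)` that `F` sends to exact complexes. -/
def relAcyclic (s : Bound) : ObjectProperty (HtpyCat C s) :=
  HtpyCat.acyclic C s ⊓ (kernelProperty F).inverseImage (HtpyCat.ι C s)

instance (s : Bound) : (relAcyclic F s).IsTriangulated := by
  dsimp only [relAcyclic]
  infer_instance

instance (s : Bound) : (relAcyclic F s).IsClosedUnderIsomorphisms := by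
  dsimp only [relAcyclic]
  infer_instance

variable {F} {s : Bound} {P : ObjectProperty (HtpyCat C s)} (hP : IsAdapted F s P)

/-- The complexes `K` in `K^s(C)` having a resolution `p : Y ⟶ K` with `Y` in `P` such that `F p`
is a quasi-isomorphism. These are the complexes on which `RF` is computed by `F`. -/
abbrev computing (_ : IsAdapted F s P) : ObjectProperty (HtpyCat C s) :=
  P.extensionProduct (relAcyclic F s)

include hP in
lemma IsAdapted.isTriangulated_computing : (computing hP).IsTriangulated := by
  have := hP.isTriangulated
  refine isTriangulated_extensionProduct (B := HtpyCat.acyclic C s) inf_le_left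
    -- Adaptedness of `P` says exactly that its exact complexes lie in `relAcyclic`.
    (fun X hX => ⟨hX.2, hP.acyclic X hX.1 hX.2⟩) ?_
  rw [← HtpyCat.qis_eq_trW]
  exact hP.exists_resolution

lemma IsAdapted.computing_of_quasiIso {X Y : HtpyCat C s} (f : Y ⟶ X) (hY : P Y)
    (hf : HtpyCat.qis C s f)
    (hF : HomotopyCategory.quasiIso E (.up ℤ) ((mapHtpyCat F s).map f.op)) : computing hP X := by
  obtain ⟨Z, g, k, hT⟩ := distinguished_cocone_triangle f
  rw [HtpyCat.qis_eq_trW] at hf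
  exact ⟨Y, Z, f, g, k, hT, hY, ((HtpyCat.acyclic C s).trW_iff_of_distinguished _ hT).1 hf,
    (acyclic_iff_quasiIso_mapHomotopy F _ ((HtpyCat.ι C s).map_distinguished _ hT)).2 hF⟩

/-- In the naturality square of `α` along `f : Y ⟶ X`, the component at `Y` is invertible because
`Y` is in `P`. Since the cone of `f` is exact and stays exact under `F`, both `L` and `G` invert
`f`, and the component at `X` follows. -/
lemma IsAdapted.isIso_of_computing {H : Type*} [Category* H] {D : Type*} [Category* D]
    (G : (HtpyCat C s)ᵒᵖ ⥤ H)
    (hG : ∀ ⦃X Y : HtpyCat C s⦄ (f : X ⟶ Y),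
      HomotopyCategory.quasiIso E (.up ℤ) ((mapHtpyCat F s).map f.op) → IsIso (G.map f.op))
    {L : (HtpyCat C s)ᵒᵖ ⥤ D} [L.IsLocalization (HtpyCat.qis C s).op] (RG : D ⥤ H)
    (α : G ⟶ L ⋙ RG) [RG.IsRightDerivedFunctor α (HtpyCat.qis C s).op] {X : HtpyCat C s}
    (hX : computing hP X) : IsIso (α.app (op X)) := by
  have := hP.isTriangulated
  obtain ⟨Y, Z, f, g, k, hT, hY, hZ⟩ := hX
  have hf : HtpyCat.qis C s f := by
    rw [HtpyCat.qis_eq_trW]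
    exact ((HtpyCat.acyclic C s).trW_iff_of_distinguished _ hT).2 hZ.1
  have h₁ : IsIso (G.map f.op) := hG f ((acyclic_iff_quasiIso_mapHomotopy F _
    ((HtpyCat.ι C s).map_distinguished _ hT)).1 hZ.2)
  have h₂ : IsIso (α.app (op Y)) := isIso_of_isRightDerivedFunctor (P := P) _
    (HtpyCat.qis_eq_trW C s) hP.exists_resolution G
    (fun _ _ f hX hY hf => hG f (hP.quasiIso_map f hX hY hf)) RG α Y hY
  have h₃ : IsIso (L.map f.op) := Localization.inverts L (HtpyCat.qis C s).op _ hf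
  have h₄ : IsIso (α.app (op X) ≫ (L ⋙ RG).map f.op) := by
    rw [← α.naturality]
    infer_instance
  have h₅ : IsIso ((L ⋙ RG).map f.op) := Functor.map_isIso RG _
  exact IsIso.of_isIso_comp_right _ ((L ⋙ RG).map f.op)

lemma IsAdapted.isIso_rightDerivedUnit [HasDerivedCategory.{w} E] [HasAdaptedSubcategory F s]
    {X : HtpyCat C s} (hX : computing hP X) : IsIso ((rightDerivedUnit F s).app (op X)) :=
  hP.isIso_of_computing _ (fun _ _ _ hf => isIso_Qh_map _ hf) (rightDerived F s) _ hX

lemma IsAdapted.isIso_mapsBound_rightDerivedUnit {t : Bound} (h : MapsBound F s t)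
    [HasAdaptedSubcategory F s] {X : HtpyCat C s} (hX : computing hP X) :
    IsIso (h.rightDerivedUnit.app (op X)) :=
  hP.isIso_of_computing (h.functor ⋙ DerCat.Q E t)
    (fun _ _ _ hf => Localization.inverts (DerCat.Q E t) (HtpyCat.qis E t) _ hf)
    h.rightDerived _ hX

end Adapted

/-! ### Stalk complexes of acyclic objects. -/

section Stalk

variable {C : Type u} [Category.{v} C] [Abelian C] {E : Type u'} [Category.{v'} E] [Abelian E]
  (F : Cᵒᵖ ⥤ E) [F.Additive]

open HomologicalComplex

lemma complexes_truncLE (s : Bound) (K : CochainComplex C ℤ) (n : ℤ) (hK : s.complexes C K) :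
    s.complexes C (K.truncLE n) := by
  have hp : (∃ n : ℤ, K.IsStrictlyGE n) → ∃ a : ℤ, (K.truncLE n).IsStrictlyGE a := by
    rintro ⟨a, _⟩
    exact ⟨a, inferInstance⟩
  have hm : ∃ a : ℤ, (K.truncLE n).IsStrictlyLE a := ⟨n, inferInstance⟩
  cases s
  · trivial
  · exact hp hK
  · exact hm
  · exact ⟨hp hK.1, hm⟩

/-- A left exact contravariant functor sends a quasi-isomorphism from a complex in degrees `≤ 0`
to a stalk complex to a morphism inducing an isomorphism on `H⁰`. -/
lemma quasiIsoAt_mapComplex_of_isStrictlyLE [PreservesFiniteLimits F] (L : CochainComplex C ℤ)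
    [L.IsStrictlyLE 0] (X : C) (φ : L ⟶ (single C (.up ℤ) 0).obj X) [QuasiIso φ] :
    QuasiIsoAt ((mapComplex F).map φ.op) 0 := by
  have h₁ : ∀ i : ℤ, i ≠ 0 → IsZero (((single C (.up ℤ) 0).obj X).X i) :=
    fun i hi => isZero_single_obj_X _ _ _ _ hi
  have hφ := (quasiIsoAt_iff' φ (-1) 0 1 (by simp) (by simp)).1 inferInstance
  rw [ShortComplex.quasiIso_iff_of_zeros' _
    ((L.isZero_of_isStrictlyLE 0 1).eq_of_tgt _ _) ((h₁ (-1) (by simp)).eq_of_src _ _)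
    ((h₁ 1 (by simp)).eq_of_tgt _ _)] at hφ
  rw [quasiIsoAt_iff' _ (-1) 0 1 (by simp) (by simp), ShortComplex.quasiIso_iff_of_zeros _
    ((F.map_isZero (h₁ 1 (by simp)).op).eq_of_src _ _)
    ((F.map_isZero (h₁ (-1) (by simp)).op).eq_of_tgt _ _)
    ((F.map_isZero (L.isZero_of_isStrictlyLE 0 1).op).eq_of_src _ _)]
  -- The hypothesis is now exactness of `L⁻¹ ⟶ L⁰ ⟶ X ⟶ 0`, which the left exact `F` turns into
  -- exactness of `0 ⟶ F X ⟶ F L⁰ ⟶ F L⁻¹`.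
  obtain ⟨hφ₁, hφ₂⟩ := hφ
  have : Mono (φ.f 0).op := by
    have : Epi (φ.f 0) := hφ₂
    infer_instance
  refine ⟨?_, ?_⟩
  · exact hφ₁.op.map_of_mono_of_preservesKernel F this inferInstance
  · exact inferInstanceAs (Mono (F.map (φ.f 0).op))

end Stalk

section Stalk

variable {C : Type u} [Category.{v} C] [Abelian C] {E : Type u'} [Category.{v'} E] [Abelian E]
  {F : Cᵒᵖ ⥤ E} [F.Additive] {s : Bound}

lemma isIso_homologyFunctor_map_iff {K L : CochainComplex C ℤ} (f : K ⟶ L) (n : ℤ) :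
    IsIso ((HomotopyCategory.homologyFunctor C (.up ℤ) n).map
      ((HomotopyCategory.quotient C (.up ℤ)).map f)) ↔ QuasiIsoAt f n := by
  rw [quasiIsoAt_iff_isIso_homologyMap]
  exact NatIso.isIso_map_iff (HomotopyCategory.homologyFunctorFactors C (.up ℤ) n) f

lemma isZero_homologyFunctor_obj {K : CochainComplex C ℤ} (n : ℤ) (h : IsZero (K.X n)) :
    IsZero ((HomotopyCategory.homologyFunctor C (.up ℤ) n).obj
      ((HomotopyCategory.quotient C (.up ℤ)).obj K)) := by
  refine IsZero.of_iso ?_ ((HomotopyCategory.homologyFunctorFactors C (.up ℤ) n).app K)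
  exact HomologicalComplex.ExactAt.isZero_homology (ShortComplex.exact_of_isZero_X₂ (K.sc n) h)

/-- For a resolution `f : Y ⟶ X` in `P`, it must be shown that `F f` is a quasi-isomorphism. Outside
degree `0` both cohomologies vanish, that of `F Y` because it is the cohomology of `RF X`.
Acyclicity says nothing about degree `0`; there left exactness is used, after truncating `Y` to
degrees `≤ 0`. -/
lemma IsAdapted.computing_single [PreservesFiniteLimits F] [HasAdaptedSubcategory F s]
    [HasDerivedCategory.{w} E] {P : ObjectProperty (HtpyCat C s)} (hP : IsAdapted F s P) (X : C)
    (hX : IsAcyclicObject F s X) : computing hP ((HtpyCat.single C s).obj X) := by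
  have := hP.isTriangulated
  obtain ⟨Y, f, hY, hf⟩ := hP.exists_resolution ((HtpyCat.single C s).obj X)
  refine hP.computing_of_quasiIso f hY hf ?_
  obtain ⟨K, hK, rfl⟩ : ∃ (K : CochainComplex C ℤ) (hK : s.complexes C K),
    Y = ⟨(HomotopyCategory.quotient C (.up ℤ)).obj K, hK⟩ := ⟨Y.obj.as, Y.property, rfl⟩
  obtain ⟨φ : K ⟶ (HomologicalComplex.single C (.up ℤ) 0).obj X, hφ⟩ :=
    (HomotopyCategory.quotient C (.up ℤ)).map_surjective f.hom
  have hφ' : QuasiIso φ := by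
    have h : HomotopyCategory.quasiIso C (.up ℤ) f.hom := hf
    rw [← hφ] at h
    exact (HomotopyCategory.quotient_map_mem_quasiIso_iff φ).1 h
  have hLE : K.IsLE 0 :=
    (HomologicalComplex.isSupported_iff_of_quasiIso φ _).2 inferInstance
  let Y : HtpyCat C s := ⟨(HomotopyCategory.quotient C (.up ℤ)).obj K, hK⟩
  let L : HtpyCat C s := ⟨(HomotopyCategory.quotient C (.up ℤ)).obj (K.truncLE 0),
    complexes_truncLE s K 0 hK⟩
  let i : L ⟶ Y := (s.homotopy C).homMk
    ((HomotopyCategory.quotient C (.up ℤ)).map (K.ιTruncLE 0))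
  have hi : HtpyCat.qis C s i :=
    (HomotopyCategory.quotient_map_mem_quasiIso_iff _).2
      (inferInstanceAs (QuasiIso (K.ιTruncLE 0)))
  -- The truncation `L` may leave `P`, so it is resolved again: `g ≫ i` is a quasi-isomorphism
  -- between objects of `P`, hence is preserved by `F`.
  obtain ⟨Y', g, hY', hg⟩ := hP.exists_resolution L
  have hgi : HtpyCat.qis C s (g ≫ i) := by
    rw [HtpyCat.qis_eq_trW] at hi hg ⊢
    exact MorphismProperty.comp_mem _ _ _ hg hi
  intro n
  let H := mapHtpyCat F s ⋙ HomotopyCategory.homologyFunctor E (.up ℤ) n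
  change IsIso (H.map f.op)
  by_cases hn : n = 0
  · have h₁ : IsIso (H.map i.op ≫ H.map g.op) := by
      rw [← H.map_comp]
      exact hP.quasiIso_map (g ≫ i) hY' hY hgi n
    have h₂ : IsIso (H.map f.op ≫ H.map i.op) := by
      rw [← H.map_comp]
      have h := quasiIsoAt_mapComplex_of_isStrictlyLE F (K.truncLE 0) X
        (K.ιTruncLE 0 ≫ φ)
      rw [← isIso_homologyFunctor_map_iff] at h
      have e : (i.hom ≫ f.hom) = (HomotopyCategory.quotient C (.up ℤ)).map (K.ιTruncLE 0 ≫ φ) := by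
        rw [Functor.map_comp, hφ]
        rfl
      subst hn
      change IsIso ((HomotopyCategory.homologyFunctor E (.up ℤ) 0).map
        ((mapHomotopy F).map (i.hom ≫ f.hom).op))
      rw [e]
      exact h
    -- The map `H i` is mono by its composite with `H g` and epi by its composite with `H f`, so it
    -- is invertible, and therefore `H f` is too.
    have : Mono (H.map i.op) := mono_of_mono _ (H.map g.op)
    have : Epi (H.map i.op) := epi_of_epi (H.map f.op) _
    have : IsIso (H.map i.op) := isIso_of_mono_of_epi _
    exact IsIso.of_isIso_comp_right _ (H.map i.op)
  · have h₁ : IsZero (H.obj (op ((HtpyCat.single C s).obj X))) := by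
      refine isZero_homologyFunctor_obj n ?_
      exact F.map_isZero (HomologicalComplex.isZero_single_obj_X (.up ℤ) 0 X (-n) (by lia)).op
    have h₂ : IsZero (H.obj (op Y)) := by
      have hY₁ : computing hP Y := ObjectProperty.le_extensionProduct_left _ _ hY
      have := hP.isIso_rightDerivedUnit hY₁
      have : IsIso ((DerCat.Q C s).map f) := Localization.inverts _ (HtpyCat.qis C s) _ hf
      refine (hX n hn).of_iso ?_
      refine ((DerivedCategory.homologyFunctorFactorsh E n).app ((mapHtpyCat F s).obj (op Y))).symm ≪≫
        (DerivedCategory.homologyFunctor E n).mapIso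
          (asIso ((rightDerivedUnit F s).app (op Y)) ≪≫
            (rightDerived F s).mapIso (asIso ((DerCat.Q C s).map f)).op.symm)
    exact ⟨0, h₁.eq_of_src _ _, h₂.eq_of_src _ _⟩

end Stalk

/-! ### Dévissage of bounded complexes. -/

section Bounded

variable {C : Type u} [Category.{v} C] [Abelian C] {E : Type u'} [Category.{v'} E] [Abelian E]
  {F : Cᵒᵖ ⥤ E} [F.Additive] {s : Bound}

lemma Bound.complexes_of_bounded (s : Bound) (K : CochainComplex C ℤ) (a b : ℤ)
    (h : ∀ i : ℤ, i < a ∨ b < i → IsZero (K.X i)) : s.complexes C K := by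
  have hp : ∃ n : ℤ, K.IsStrictlyGE n :=
    ⟨a, (CochainComplex.isStrictlyGE_iff _ _).2 fun i hi => h i (.inl hi)⟩
  have hm : ∃ n : ℤ, K.IsStrictlyLE n :=
    ⟨b, (CochainComplex.isStrictlyLE_iff _ _).2 fun i hi => h i (.inr hi)⟩
  cases s
  · trivial
  · exact hp
  · exact hm
  · exact ⟨hp, hm⟩

/-- The triangle lives in the ambient `K(C)`; completing its first map inside `K^s(C)` yields a
third vertex isomorphic to the given one, because the inclusion is triangulated and fully faithful.
-/
lemma HtpyCat.ext_of_distinguished (N : ObjectProperty (HtpyCat C s)) [N.IsTriangulated]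
    [N.IsClosedUnderIsomorphisms] (T : Triangle (HomotopyCategory C (.up ℤ)))
    (hT : T ∈ distTriang (HomotopyCategory C (.up ℤ))) (h₁ : s.homotopy C T.obj₁)
    (h₂ : s.homotopy C T.obj₂) (h₃ : s.homotopy C T.obj₃) (hN₁ : N ⟨T.obj₁, h₁⟩)
    (hN₃ : N ⟨T.obj₃, h₃⟩) : N ⟨T.obj₂, h₂⟩ := by
  let f : (⟨T.obj₁, h₁⟩ : HtpyCat C s) ⟶ ⟨T.obj₂, h₂⟩ := (s.homotopy C).homMk T.mor₁
  obtain ⟨Z, g, k, hZ⟩ := distinguished_cocone_triangle f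
  let e : ((HtpyCat.ι C s).mapTriangle.obj (Triangle.mk f g k)).obj₃ ≅ T.obj₃ :=
    Triangle.π₃.mapIso (isoTriangleOfIso₁₂ _ _ ((HtpyCat.ι C s).map_distinguished _ hZ) hT
      (Iso.refl _) (Iso.refl _) ((Category.comp_id _).trans (Category.id_comp _).symm))
  let e' : Z ≅ ⟨T.obj₃, h₃⟩ := (HtpyCat.ι C s).preimageIso e
  exact N.ext_of_isTriangulatedClosed₂ _ hZ hN₁ (N.prop_of_iso e'.symm hN₃)

lemma HtpyCat.prop_single (N : ObjectProperty (HtpyCat C s)) [N.IsTriangulated]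
    [N.IsClosedUnderIsomorphisms] (X : C) (a : ℤ) (hX : N ((HtpyCat.single C s).obj X)) :
    N ⟨(HomotopyCategory.quotient C (.up ℤ)).obj ((HomologicalComplex.single C (.up ℤ) a).obj X),
      s.complexes_single X a⟩ :=
  N.prop_of_iso ((HtpyCat.ι C s).preimageIso
    (((HtpyCat.ι C s).commShiftIso (-a)).app ((HtpyCat.single C s).obj X) ≪≫
      ((HomotopyCategory.singleFunctors C).shiftIso (-a) a 0 (by simp)).app X))
    (N.le_shift (-a) _ hX)

lemma HtpyCat.isZero_mk {K : CochainComplex C ℤ} (hK : s.complexes C K)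
    (h : ∀ i : ℤ, IsZero (K.X i)) :
    IsZero (⟨(HomotopyCategory.quotient C (.up ℤ)).obj K, hK⟩ : HtpyCat C s) := by
  have hK₀ : IsZero K := (IsZero.iff_id_eq_zero K).2 (by
    ext i
    exact (h i).eq_of_src _ _)
  refine (IsZero.iff_id_eq_zero _).2 (ObjectProperty.hom_ext _ ?_)
  exact (IsZero.iff_id_eq_zero _).1 (Functor.map_isZero (HomotopyCategory.quotient C (.up ℤ)) hK₀)

lemma HtpyCat.isZero_single {X : C} (hX : IsZero X) : IsZero ((HtpyCat.single C s).obj X) := by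
  refine HtpyCat.isZero_mk (s.complexes_single X 0) (fun i => ?_)
  by_cases hi : i = 0
  · subst hi
    exact hX.of_iso (HomologicalComplex.singleObjXSelf (.up ℤ) 0 X)
  · exact HomologicalComplex.isZero_single_obj_X _ _ _ _ hi

lemma HtpyCat.prop_of_isZero (N : ObjectProperty (HtpyCat C s)) [N.IsTriangulated]
    [N.IsClosedUnderIsomorphisms] {Z : HtpyCat C s} (hZ : IsZero Z) : N Z := by
  obtain ⟨Z', hZ', h'⟩ := N.exists_prop_of_containsZero
  exact N.prop_of_iso (hZ'.iso hZ) h'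

/-- Induction on the number `n` of degrees `a, …, a + n - 1` in which `K` may be nonzero. The lowest
term is a quotient stalk of `K`, and the kernel is the brutal truncation to degrees `> a`; the
sequence splits degreewise, hence gives a distinguished triangle. -/
lemma HtpyCat.prop_of_bounded (N : ObjectProperty (HtpyCat C s)) [N.IsTriangulated]
    [N.IsClosedUnderIsomorphisms] (n : ℕ) (K : CochainComplex C ℤ) (a : ℤ)
    (hK : s.complexes C K) (h₀ : ∀ i : ℤ, i < a ∨ a + n ≤ i → IsZero (K.X i))
    (h : ∀ i : ℤ, N ((HtpyCat.single C s).obj (K.X i))) :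
    N ⟨(HomotopyCategory.quotient C (.up ℤ)).obj K, hK⟩ := by
  induction n generalizing K a with
  | zero =>
    exact HtpyCat.prop_of_isZero N (HtpyCat.isZero_mk hK fun i => h₀ i (by lia))
  | succ n ih =>
    let f : K ⟶ (HomologicalComplex.single C (.up ℤ) a).obj (K.X a) :=
      HomologicalComplex.mkHomToSingle (𝟙 (K.X a))
        (fun i hi => (h₀ i (by
          have : i + 1 = a := hi
          lia)).eq_of_src _ _)
    have hfa : IsIso (f.f a) := by
      dsimp [f]
      rw [HomologicalComplex.mkHomToSingle_f]
      infer_instance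
    have hZ (i : ℤ) (hi : i ≠ a) : IsZero (((HomologicalComplex.single C (.up ℤ) a).obj (K.X a)).X i) :=
      HomologicalComplex.isZero_single_obj_X _ _ _ _ hi
    have hf (i : ℤ) : ∃ t : ((HomologicalComplex.single C (.up ℤ) a).obj (K.X a)).X i ⟶ K.X i,
        t ≫ f.f i = 𝟙 _ := by
      by_cases hi : i = a
      · subst hi
        exact ⟨inv (f.f i), IsIso.inv_hom_id _⟩
      · exact ⟨0, (hZ i hi).eq_of_src _ _⟩
    choose t ht using hf
    have hfi (i : ℤ) : Epi (f.f i) := (SplitEpi.mk (t i) (ht i)).epi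
    have hepi : Epi f := HomologicalComplex.epi_of_epi_f f hfi
    let S : ShortComplex (CochainComplex C ℤ) := .mk (kernel.ι f) f (kernel.condition f)
    have hS : S.ShortExact :=
      { exact := ShortComplex.exact_of_f_is_kernel _ (kernelIsKernel f)
        mono_f := inferInstanceAs (Mono (kernel.ι f))
        epi_g := hepi }
    have hS' := (HomologicalComplex.shortExact_iff_degreewise_shortExact S).1 hS
    let σ (i : ℤ) : (S.map (HomologicalComplex.eval _ _ i)).Splitting :=
      .ofExactOfSection _ (hS' i).exact (t i) (ht i) (hS' i).mono_f
    have hT := (HomotopyCategory.distinguished_iff_iso_trianglehOfDegreewiseSplit _).2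
      ⟨S, σ, ⟨Iso.refl _⟩⟩
    have hS₁ : IsZero (S.X₁.X a) := (hS' a).isIso_g_iff.1 hfa
    have hS₂ (i : ℤ) (hi : i ≠ a) : IsIso (S.f.f i) := (hS' i).isIso_f_iff.2 (hZ i hi)
    have hS₃ (i : ℤ) (hi : i < a + 1 ∨ a + 1 + n ≤ i) : IsZero (S.X₁.X i) := by
      by_cases hia : i = a
      · rwa [hia]
      · have := hS₂ i hia
        exact (h₀ i (by push_cast; lia)).of_iso (asIso (S.f.f i))
    have hK₁ : s.complexes C S.X₁ :=
      s.complexes_of_bounded _ (a + 1) (a + n) (fun i hi => hS₃ i (by lia))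
    refine HtpyCat.ext_of_distinguished N _ hT hK₁ hK (s.complexes_single _ _)
      (ih _ (a + 1) hK₁ hS₃ (fun i => ?_)) (HtpyCat.prop_single N _ _ (h a))
    by_cases hia : i = a
    · subst hia
      exact HtpyCat.prop_of_isZero N (HtpyCat.isZero_single hS₁)
    · have := hS₂ i hia
      exact N.prop_of_iso ((HtpyCat.single C s).mapIso (asIso (S.f.f i))).symm (h i)

end Bounded

/-! ### Finite resolutions and the derived unit. -/

section Reflexive

variable {A : Type u} [Category.{v} A] [Abelian A]

open ComplexShape in
/-- A left resolution of length `n`, viewed as a bounded cochain complex. -/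
lemma exists_complex_of_leftDimLE {𝓕 : ObjectProperty A} {X : A} {n : ℕ}
    (hX : LeftDimLE 𝓕 X (n : ℕ∞)) :
    ∃ (K : CochainComplex A ℤ) (φ : K ⟶ (HomologicalComplex.single A (.up ℤ) 0).obj X),
      QuasiIso φ ∧ (∀ i : ℤ, i < -n ∨ 0 < i → IsZero (K.X i)) ∧
        ∀ i : ℤ, IsZero (K.X i) ∨ 𝓕.isoClosure (K.X i) := by
  obtain ⟨L, ε, w, hε, hex, hL, h𝓕, h₀⟩ := hX
  let π : L ⟶ (ChainComplex.single₀ A).obj X := (L.toSingle₀Equiv X).symm ⟨ε, w⟩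
  have hπ : QuasiIso π := ⟨fun i => by
    obtain _ | i := i
    · rw [ChainComplex.quasiIsoAt₀_iff, ShortComplex.quasiIso_iff_of_zeros' _
        (L.shape 0 0 (by simp)) rfl rfl]
      have hπ₀ : π.f 0 = ε := by simp [π]
      refine ⟨?_, ?_⟩
      · have h : (ShortComplex.mk (L.d 1 0) (π.f 0) (by rw [hπ₀]; exact w)).Exact := by
          simp only [hπ₀]
          exact hex
        exact h
      · change Epi (π.f 0)
        rwa [hπ₀]
    · rw [quasiIsoAt_iff_exactAt _ _ (hL i)]
      exact HomologicalComplex.exactAt_single_obj _ _ _ _ (by simp)⟩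
  have hpos (i : ℤ) (hi : 0 < i) : IsZero ((L.extend embeddingDownNat).X i) :=
    L.isZero_extend_X _ _ (fun k hk => by
      have : -(k : ℤ) = i := hk
      lia)
  refine ⟨L.extend embeddingDownNat, HomologicalComplex.extendMap π embeddingDownNat ≫
    (HomologicalComplex.extendSingleIso _ _ _ _ (by simp)).hom, inferInstance, ?_, ?_⟩
  · rintro i (hi | hi)
    · obtain ⟨k, rfl⟩ := Int.exists_eq_neg_ofNat (a := i) (by lia)
      exact (h₀ k (by exact_mod_cast (by lia : n < k))).of_iso
        (L.extendXIso embeddingDownNat (i := k) (by simp))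
    · exact hpos i hi
  · intro i
    by_cases hi : 0 < i
    · exact .inl (hpos i hi)
    · obtain ⟨k, rfl⟩ := Int.exists_eq_neg_ofNat (a := i) (by lia)
      let e := L.extendXIso embeddingDownNat (i := k) (i' := -k) (by simp)
      exact (h𝓕 k).symm.imp (fun h => h.of_iso e) (fun h => ⟨_, h, ⟨e⟩⟩)

variable {B : Type u'} [Category.{v'} B] [Abelian B]
  {Φ : Aᵒᵖ ⥤ B} {Ψ : Bᵒᵖ ⥤ A} [Φ.Additive] [Ψ.Additive] (adj : Φ.rightOp ⊣ Ψ) {s t : Bound}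
  [HasAdaptedSubcategory Φ s] [HasAdaptedSubcategory Ψ t]

lemma isIso_unit_of_isZero {X : A} (hX : IsZero X) : IsIso (adj.unit.app X) :=
  ⟨0, hX.eq_of_src _ _, (Ψ.map_isZero (Φ.map_isZero hX.op).op).eq_of_src _ _⟩

lemma isIso_complexUnit_app (K : CochainComplex A ℤ)
    (hK : ∀ i : ℤ, IsIso (adj.unit.app (K.X i))) : IsIso ((complexUnit adj).app K) := by
  have (i : ℤ) : IsIso (((complexUnit adj).app K).f i) := by
    have := hK (- -i)
    exact IsIso.comp_isIso' inferInstance this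
  exact HomologicalComplex.Hom.isIso_of_components _

variable [HasDerivedCategory.{w} A]

/-- The derived unit is an isomorphism on a complex `K` for which `RΦ` and `RΨ` are computed by
`Φ` on `K` and by `Ψ` on `Φ K`, and for which `K ⟶ Ψ Φ K` is a quasi-isomorphism. -/
lemma isIso_derivedUnit_app (h : MapsBound Φ s t) {P : ObjectProperty (HtpyCat A s)}
    (hP : IsAdapted Φ s P) {Q : ObjectProperty (HtpyCat B t)} (hQ : IsAdapted Ψ t Q)
    (K : HtpyCat A s) (h₁ : computing hP K) (h₂ : computing hQ (h.functor.obj (op K)))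
    (h₃ : HomotopyCategory.quasiIso A (.up ℤ) ((homotopyUnit adj).app K.obj)) :
    IsIso ((derivedUnit adj h).app ((DerCat.Q A s).obj K)) := by
  have := hP.isIso_mapsBound_rightDerivedUnit h h₁
  have := hQ.isIso_rightDerivedUnit h₂
  have := isIso_Qh_map _ h₃
  -- In this identity every arrow except the derived unit is already known to be invertible.
  have hf := derivedUnit_fac adj h K
  have h₄ : IsIso ((rightDerived Ψ t).map (h.rightDerivedUnit.app (op K)).op) :=
    Functor.map_isIso _ _
  have h₅ : IsIso ((derivedUnit adj h).app ((DerCat.Q A s).obj K) ≫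
      (rightDerived Ψ t).map (h.rightDerivedUnit.app (op K)).op) := by
    rw [hf]
    exact IsIso.comp_isIso' inferInstance (IsIso.comp_isIso' inferInstance inferInstance)
  exact IsIso.of_isIso_comp_right _
    ((rightDerived Ψ t).map (h.rightDerivedUnit.app (op K)).op)

end Reflexive

end DerivedReflexive

/-! ### The reflexivity theorem. -/

open DerivedReflexive in
/-- `A`, `B` are abelian categories, `(Φ, Ψ)` is a right adjoint pair of contravariant functors
(`Hom_A(X, Ψ Y) ≅ Hom_B(Y, Φ X)`), and `s`, `t` are the boundedness conditions for `D^s(A)`, `D^t(B)`. -/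
theorem mainTheorem7 {A : Type u} [Category.{v} A] [Abelian A]
    {B : Type u'} [Category.{v'} B] [Abelian B]
    [HasDerivedCategory.{w} A] [HasDerivedCategory.{w'} B]
    (Φ : Aᵒᵖ ⥤ B) (Ψ : Bᵒᵖ ⥤ A) [Φ.Additive] [Ψ.Additive] (adj : Φ.rightOp ⊣ Ψ)
    (s t : DerivedReflexive.Bound)
    [DerivedReflexive.HasAdaptedSubcategory Φ s] [DerivedReflexive.HasAdaptedSubcategory Ψ t]
    (h : DerivedReflexive.MapsBound Φ s t)
    (X : A) (hX : DerivedReflexive.HasFiniteLeftDim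
      (DerivedReflexive.GorensteinClass adj s t) X) :
    DerivedReflexive.IsDReflexive adj h X := by
  -- Both functors are left exact: `Φ.rightOp` is a left adjoint, so `Φ` turns finite colimits of
  -- `A` into limits, and `Ψ` is a right adjoint.
  have : PreservesFiniteColimits Φ.rightOp :=
    (adj.leftAdjoint_preservesColimits :
      PreservesColimitsOfSize.{0, 0} Φ.rightOp).preservesFiniteColimits
  have : PreservesFiniteLimits Φ := preservesFiniteLimits_of_rightOp Φ
  have : PreservesFiniteLimits Ψ :=
    (adj.rightAdjoint_preservesLimits : PreservesLimitsOfSize.{0, 0} Ψ).preservesFiniteLimits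
  obtain ⟨P, hP⟩ := HasAdaptedSubcategory.exists_isAdapted (F := Φ) (s := s)
  obtain ⟨Q, hQ⟩ := HasAdaptedSubcategory.exists_isAdapted (F := Ψ) (s := t)
  have := hP.isTriangulated_computing
  have := hQ.isTriangulated_computing
  obtain ⟨n, hn⟩ := hX
  obtain ⟨L, φ, hφ, h₀, hG⟩ := exists_complex_of_leftDimLE hn
  have hL : s.complexes A L := s.complexes_of_bounded L (-n) 0 h₀
  let K : HtpyCat A s := ⟨(HomotopyCategory.quotient A (.up ℤ)).obj L, hL⟩
  have h₁ : computing hP K :=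
    HtpyCat.prop_of_bounded _ (n + 1) L (-n) hL (fun i hi => h₀ i (by lia)) (fun i => by
      obtain hi | ⟨G, hG, ⟨e⟩⟩ := hG i
      · exact HtpyCat.prop_of_isZero _ (HtpyCat.isZero_single hi)
      · exact (computing hP).prop_of_iso ((HtpyCat.single A s).mapIso e).symm
          (hP.computing_single G hG.acyclic))
  have h₂ : computing hQ (h.functor.obj (op K)) :=
    -- The term of `Φ L` in degree `i` is `Φ` of `L` in degree `-i`, so the `n + 1` degrees `-n, …,
    -- 0` become `0, …, n`.
    HtpyCat.prop_of_bounded _ (n + 1) ((mapComplex Φ).obj (op L)) 0 (h L hL)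
      (fun i hi => Φ.map_isZero (h₀ (-i) (by lia)).op) (fun i => by
      obtain hi | ⟨G, hG, ⟨e⟩⟩ := hG (-i)
      · exact HtpyCat.prop_of_isZero _ (HtpyCat.isZero_single (Φ.map_isZero hi.op))
      · exact (computing hQ).prop_of_iso ((HtpyCat.single B t).mapIso (Φ.mapIso e.op))
          (hQ.computing_single _ hG.acyclic_map))
  have h₃ : HomotopyCategory.quasiIso A (.up ℤ) ((homotopyUnit adj).app K.obj) := by
    have := isIso_complexUnit_app adj L (fun i => by
      obtain hi | ⟨G, hG, ⟨e⟩⟩ := hG i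
      · exact isIso_unit_of_isZero adj hi
      · exact (NatTrans.isIso_app_iff_of_iso adj.unit e).2 hG.isIso_unit)
    exact (HomotopyCategory.quotient_map_mem_quasiIso_iff _).2
      (inferInstanceAs (QuasiIso ((complexUnit adj).app L)))
  have h₄ := isIso_derivedUnit_app adj h hP hQ K h₁ h₂ h₃
  let f : K ⟶ (HtpyCat.single A s).obj X :=
    (s.homotopy A).homMk ((HomotopyCategory.quotient A (.up ℤ)).map φ)
  have hf : HtpyCat.qis A s f := (HomotopyCategory.quotient_map_mem_quasiIso_iff φ).2 hφ
  have hQf : IsIso ((DerCat.Q A s).map f) := Localization.inverts _ (HtpyCat.qis A s) _ hf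
  -- Naturality carries invertibility from the resolution to `X` along their isomorphism in
  -- `D^s(A)`.
  exact (NatTrans.isIso_app_iff_of_iso (derivedUnit adj h) (asIso ((DerCat.Q A s).map f))).1 h₄
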